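/- **Theorem 1.** Let $\nu>-\frac12$, let $I_\nu$ be the modified Bessel function of the first kind, and for real $n>0$ put $${\cal I}_n=\int_0^\infty\left(e^{-x}\,\frac{\Gamma(1+\nu)I_\nu(x)}{(x/2)^\nu}\right)^{n}dx ,\qquad \psi(x)=x-\log\frac{\Gamma(1+\nu)I_\nu(x)}{(x/2)^\nu}\quad(x>0).$$ Then the integral ${\cal I}_n$ converges for all sufficiently large $n$. The map $\psi$ is a bijection of $(0,\infty)$ onto itself, and, writing $x=x(\tau)$ for the inverse of $\tau=\psi(x)$, there are real numbers $A_k=A_k(\nu)$ and a $\tau_0>0$ with $\frac{dx}{d\tau}=\sum_{k=0}^\infty A_k\tau^k$ for $0<\tau<\tau_0$. As $n\to\infty$ through real values, ${\cal I}_n$ has the asymptotic expansion $${\cal I}_n\sim\sum_{k=0}^\infty\frac{k!\,A_k}{n^{k+1}},\qquad\text{i.e.}\qquad {\cal I}_n-\sum_{k=0}^{N-1}\frac{k!\,A_k}{n^{k+1}}=O\!\left(n^{-N-1}\right)\ \text{ for every fixed } N\ge 0 .$$ Its first seven terms are $${\cal I}_n=\frac1n\left\{1+\frac{1}{2(1+\nu)n}+\frac{3}{4(1+\nu)^2n^2}+\frac{3(8+3\nu)}{8(1+\nu)^3(2+\nu)n^3}+\frac{15(8+\nu)}{16(1+\nu)^4(2+\nu)n^4}+\frac{15(142+11\nu-5\nu^2)}{32(1+\nu)^5(2+\nu)(3+\nu)n^5}+\frac{105(272+8\nu-71\nu^2-5\nu^3)}{64(1+\nu)^6(2+\nu)^2(3+\nu)n^6}\right\}+O(n^{-8}).$$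 -/

import Mathlib

open Filter Set MeasureTheory Asymptotics
open scoped Nat Topology

noncomputable section

/-- The modified Bessel function of the first kind of real order `ν`, at a real argument `x > 0`:
`I_ν(x) = (x/2)^ν ∑_{k ≥ 0} (x²/4)^k / (k! Γ(ν + k + 1))`. -/
def besselI (ν x : ℝ) : ℝ :=
  (x / 2) ^ ν * ∑' k : ℕ, (x ^ 2 / 4) ^ k / ((k ! : ℝ) * Real.Gamma (ν + k + 1))

/-- The normalised Bessel function `Γ(1+ν) I_ν(x) / (x/2)^ν`, for `x > 0`. -/
def normBesselI (ν x : ℝ) : ℝ :=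
  Real.Gamma (1 + ν) * besselI ν x / (x / 2) ^ ν

/-- The integrand `(e^{-x} Γ(1+ν) I_ν(x) / (x/2)^ν)^n`, with a real exponent `n`. -/
def besselIntegrand (ν n x : ℝ) : ℝ :=
  (Real.exp (-x) * normBesselI ν x) ^ n

/-- The integral `𝓘_n = ∫_0^∞ (e^{-x} Γ(1+ν) I_ν(x) / (x/2)^ν)^n dx`. -/
def besselIntegral (ν n : ℝ) : ℝ :=
  ∫ x in Ioi (0 : ℝ), besselIntegrand ν n x

/-- The phase function `ψ(x) = x - log (Γ(1+ν) I_ν(x) / (x/2)^ν)`, for `x > 0`. -/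
def phase (ν x : ℝ) : ℝ :=
  x - Real.log (normBesselI ν x)

/-- The inverse function `τ ↦ x(τ)` of `τ = ψ(x)`, where `x` ranges over `(0, ∞)`. -/
def phaseInv (ν : ℝ) : ℝ → ℝ :=
  Function.invFunOn (phase ν) (Ioi 0)

/-- The numbers `A k` are the coefficients of the power series of `dx/dτ` at `τ = 0`:
for all small `τ > 0` the derivative `dx/dτ` exists and `dx/dτ = ∑_k A_k τ^k`. -/
def IsInversionCoeff (ν : ℝ) (A : ℕ → ℝ) : Prop :=
  ∃ τ₀ : ℝ, 0 < τ₀ ∧ ∀ τ ∈ Ioo 0 τ₀,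
    ∃ d : ℝ, HasDerivAt (phaseInv ν) d τ ∧ HasSum (fun k : ℕ => A k * τ ^ k) d

end

/-! Write `f` for the normalised Bessel function, so that the integrand is `e^{-nψ}` with `ψ = x -
log f`. Integration by parts and the substitution `τ = ψ(x)` give `𝓘_n = n ∫ x(τ) e^{-nτ} dτ`
(`besselIntegral_eq`). Watson's lemma (`watson_isBigO`) then needs only the behaviour of `x(τ)` at
`0+` and an exponential bound on it; nothing has to be known about `dx/dτ` for large `τ`. If `x(τ) ~
∑ a_k τ^{k+1}`, then `A_k = (k+1) a_k`, and the coefficient of `1/n^{k+1}` is `(k+1)! a_k = k! A_k`.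

The global input is `ψ' ≥ δ/(1+x)` on `[0, ∞)` for some `δ > 0` (`decayExponent_div_le_phaseDeriv`),
a consequence of Bessel's equation and `2ν + 1 > 0`. Hence `ψ ≥ δ log(1+x)`, which gives
surjectivity of `ψ`, the decay `e^{-nψ} ≤ (1+x)^{-δn}` and the growth bound `x(τ) ≤ e^{τ/δ}`.

The local input is that `ψ` extends analytically to `0` with `ψ(0) = 0` and `ψ'(0) = 1`, so `x(τ)`
agrees near `0+` with an analytic local inverse (`exists_analyticAt_phaseInv`). The seven explicit
terms come from expanding `log f` to order `x^6` and reverting the series (`log_sub_isBigO`,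
`reversion_sub_isBigO`). -/

/-! ### The power series factor of the Bessel function -/

/-- The entire function `∑ z ^ k / (k! Γ(μ + k + 1))`, the power series factor of `besselI μ`. -/
noncomputable def besselSeries (μ z : ℝ) : ℝ :=
  ∑' k : ℕ, z ^ k / ((k ! : ℝ) * Real.Gamma (μ + k + 1))

/-- The coefficients of `besselSeries`. -/
noncomputable def besselCoeff (μ : ℝ) (k : ℕ) : ℝ := ((k ! : ℝ) * Real.Gamma (μ + k + 1))⁻¹

lemma besselCoeff_pos {μ : ℝ} (hμ : -1 < μ) (k : ℕ) : 0 < besselCoeff μ k := by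
  have h : 0 < Real.Gamma (μ + k + 1) := Real.Gamma_pos_of_pos (by
    have : (0 : ℝ) ≤ k := k.cast_nonneg
    linarith)
  unfold besselCoeff
  positivity

lemma besselSeries_eq_tsum (μ z : ℝ) : besselSeries μ z = ∑' k : ℕ, besselCoeff μ k * z ^ k := by
  simp only [besselSeries, besselCoeff, div_eq_mul_inv, mul_comm]

/-- Both sides carry the same Gamma value. This identity makes differentiation raise the order by
one, and with `besselCoeff_eq` it gives the ratio of consecutive coefficients. -/
lemma succ_mul_besselCoeff_succ (μ : ℝ) (k : ℕ) :
    ((k : ℝ) + 1) * besselCoeff μ (k + 1) = besselCoeff (μ + 1) k := by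
  have h : μ + ((k + 1 : ℕ) : ℝ) + 1 = μ + 1 + k + 1 := by push_cast; ring
  have hk : (k : ℝ) + 1 ≠ 0 := by positivity
  simp only [besselCoeff, h, Nat.factorial_succ, mul_inv]
  push_cast
  rw [mul_inv]
  field_simp

lemma besselCoeff_eq {μ : ℝ} (hμ : -1 < μ) (k : ℕ) :
    besselCoeff μ k = (μ + 1 + k) * besselCoeff (μ + 1) k := by
  have hk : (0 : ℝ) ≤ k := k.cast_nonneg
  have hpos : 0 < μ + k + 1 := by linarith
  have h : μ + 1 + k + 1 = (μ + k + 1) + 1 := by ring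
  have hG := (Real.Gamma_pos_of_pos hpos).ne'
  have hf : (k ! : ℝ) ≠ 0 := by positivity
  simp only [besselCoeff, h, Real.Gamma_add_one hpos.ne']
  field_simp
  ring

lemma hasFPowerSeriesOnBall_besselSeries {μ : ℝ} (hμ : -1 < μ) :
    HasFPowerSeriesOnBall (besselSeries μ)
      (FormalMultilinearSeries.ofScalars ℝ (besselCoeff μ)) 0 ⊤ := by
  have hr : (FormalMultilinearSeries.ofScalars ℝ (besselCoeff μ)).radius = ⊤ := by
    refine FormalMultilinearSeries.ofScalars_radius_eq_top_of_tendsto ℝ _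
      (Eventually.of_forall fun k => (besselCoeff_pos hμ k).ne') ?_
    have key : ∀ k : ℕ, ‖besselCoeff μ k.succ‖ / ‖besselCoeff μ k‖ =
        ((k : ℝ) + 1)⁻¹ * (μ + 1 + k)⁻¹ := by
      intro k
      have hk : (0 : ℝ) ≤ k := k.cast_nonneg
      have h1 := succ_mul_besselCoeff_succ μ k
      have h2 := besselCoeff_eq hμ k
      have h3 := besselCoeff_pos (show -1 < μ + 1 by linarith) k
      have h4 : 0 < μ + 1 + k := by linarith
      rw [Real.norm_of_nonneg (besselCoeff_pos hμ _).le,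
        Real.norm_of_nonneg (besselCoeff_pos hμ _).le, h2, Nat.succ_eq_add_one,
        ← mul_right_inj' (show (k : ℝ) + 1 ≠ 0 by positivity), ← mul_div_assoc, h1]
      field_simp
    simp only [key]
    have hk : Tendsto (fun k : ℕ => (k : ℝ)) atTop atTop := tendsto_natCast_atTop_atTop
    have := (tendsto_inv_atTop_zero.comp (tendsto_atTop_add_const_right _ 1 hk)).mul
      (tendsto_inv_atTop_zero.comp (tendsto_atTop_add_const_left _ (μ + 1) hk))
    simpa using this
  have := (FormalMultilinearSeries.ofScalars ℝ (besselCoeff μ)).hasFPowerSeriesOnBall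
    (by rw [hr]; exact ENNReal.zero_lt_top)
  rw [hr] at this
  convert this using 1
  funext z
  rw [besselSeries_eq_tsum]
  simp [FormalMultilinearSeries.sum, mul_comm]

lemma hasSum_besselSeries {μ : ℝ} (hμ : -1 < μ) (z : ℝ) :
    HasSum (fun k => besselCoeff μ k * z ^ k) (besselSeries μ z) := by
  have := (hasFPowerSeriesOnBall_besselSeries hμ).hasSum (y := z) (by simp)
  simpa [mul_comm] using this

lemma analyticAt_besselSeries {μ : ℝ} (hμ : -1 < μ) (z : ℝ) : AnalyticAt ℝ (besselSeries μ) z :=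
  (hasFPowerSeriesOnBall_besselSeries hμ).analyticAt_of_mem (by simp)

lemma hasDerivAt_besselSeries {μ : ℝ} (hμ : -1 < μ) (z : ℝ) :
    HasDerivAt (besselSeries μ) (besselSeries (μ + 1) z) z := by
  have hμ' : -1 < μ + 1 := by linarith
  have hshift : ∀ (y : ℝ) (k : ℕ), besselCoeff μ (k + 1) * (((k + 1 : ℕ) : ℝ) * y ^ (k + 1 - 1)) =
      besselCoeff (μ + 1) k * y ^ k := by
    intro y k
    rw [← succ_mul_besselCoeff_succ]
    push_cast
    ring
  have hsum : ∀ y : ℝ, HasSum (fun k : ℕ => besselCoeff μ k * ((k : ℝ) * y ^ (k - 1)))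
      (besselSeries (μ + 1) y) := by
    intro y
    rw [← hasSum_nat_add_iff' 1]
    simp only [hshift]
    simpa using hasSum_besselSeries hμ' y
  have h := hasDerivAt_tsum_of_isPreconnected (g := fun k y => besselCoeff μ k * y ^ k)
    (g' := fun k y => besselCoeff μ k * ((k : ℝ) * y ^ (k - 1)))
    -- The differentiated series at the radius `|z| + 1` dominates termwise on the ball, because the
    -- coefficients are positive.
    (u := fun k => besselCoeff μ k * ((k : ℝ) * (|z| + 1) ^ (k - 1)))
    (t := Metric.ball 0 (|z| + 1)) (y₀ := z) (y := z) (hsum _).summable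
    Metric.isOpen_ball (convex_ball _ _).isPreconnected
    (fun k y _ => (hasDerivAt_pow k y).const_mul _) ?_ (by simp)
    (hasSum_besselSeries hμ z).summable (by simp)
  · rw [(hsum z).tsum_eq] at h
    exact h.congr_of_eventuallyEq (Eventually.of_forall fun y => besselSeries_eq_tsum μ y)
  · intro k y hy
    have hy' : |y| ≤ |z| + 1 := by simpa using (mem_ball_zero_iff.1 hy).le
    rw [norm_mul, norm_mul, norm_pow, Real.norm_of_nonneg (besselCoeff_pos hμ k).le,
      Real.norm_natCast, Real.norm_eq_abs]
    have := (besselCoeff_pos hμ k).le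
    gcongr

lemma besselSeries_recurrence {μ : ℝ} (hμ : -1 < μ) (z : ℝ) :
    besselSeries μ z = (μ + 1) * besselSeries (μ + 1) z + z * besselSeries (μ + 1 + 1) z := by
  have h1 := (hasSum_besselSeries (show -1 < μ + 1 by linarith) z).mul_left (μ + 1)
  have h2 : HasSum (fun k : ℕ => (k : ℝ) * besselCoeff (μ + 1) k * z ^ k)
      (z * besselSeries (μ + 1 + 1) z) := by
    rw [← hasSum_nat_add_iff' 1]
    have := (hasSum_besselSeries (show -1 < μ + 1 + 1 by linarith) z).mul_left z
    simp only [Finset.range_one, Finset.sum_singleton, Nat.cast_zero, zero_mul, sub_zero]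
    convert! this using 2 with k
    rw [← succ_mul_besselCoeff_succ (μ + 1)]
    push_cast
    ring
  refine (hasSum_besselSeries hμ z).unique ?_
  convert! h1.add h2 using 2 with k
  rw [besselCoeff_eq hμ]
  ring

lemma besselSeries_pos {μ : ℝ} (hμ : -1 < μ) {z : ℝ} (hz : 0 ≤ z) : 0 < besselSeries μ z := by
  have h := hasSum_besselSeries hμ z
  refine (besselCoeff_pos hμ 0).trans_le ?_
  have := h.summable.sum_le_tsum (Finset.range 1)
    (fun k _ => mul_nonneg (besselCoeff_pos hμ k).le (pow_nonneg hz k))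
  rw [h.tsum_eq] at this
  simpa using this

lemma besselSeries_zero (μ : ℝ) : besselSeries μ 0 = (Real.Gamma (1 + μ))⁻¹ := by
  rw [besselSeries_eq_tsum, tsum_eq_single 0 (by intro k hk; simp [hk])]
  simp [besselCoeff, add_comm]

/-! ### The phase and its derivative -/

/-- The even entire extension of `normBesselI ν` to the real line. -/
noncomputable def normBesselExt (ν x : ℝ) : ℝ := Real.Gamma (1 + ν) * besselSeries ν (x ^ 2 / 4)

/-- The quotient of the derivative of `normBesselExt ν` by `x`. -/
noncomputable def normBesselSlope (ν x : ℝ) : ℝ :=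
  Real.Gamma (1 + ν) * besselSeries (ν + 1) (x ^ 2 / 4) / 2

/-- The analytic extension of `phase ν` to the real line. -/
noncomputable def phaseExt (ν x : ℝ) : ℝ := x - Real.log (normBesselExt ν x)

/-- The derivative of `phaseExt ν`. -/
noncomputable def phaseDeriv (ν x : ℝ) : ℝ :=
  (normBesselExt ν x - x * normBesselSlope ν x) / normBesselExt ν x

lemma normBesselI_eq_ext (ν : ℝ) {x : ℝ} (hx : 0 < x) : normBesselI ν x = normBesselExt ν x := by
  have h : (x / 2) ^ ν ≠ 0 := (Real.rpow_pos_of_pos (by positivity) ν).ne'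
  rw [normBesselI, besselI, normBesselExt, besselSeries]
  field_simp

lemma phase_eq_ext (ν : ℝ) {x : ℝ} (hx : 0 < x) : phase ν x = phaseExt ν x := by
  rw [phase, phaseExt, normBesselI_eq_ext ν hx]

section order_gt_neg_one

variable {ν : ℝ}

lemma normBesselExt_pos (hν : -1 < ν) (x : ℝ) : 0 < normBesselExt ν x :=
  mul_pos (Real.Gamma_pos_of_pos (by linarith)) (besselSeries_pos hν (by positivity))

lemma normBesselSlope_pos (hν : -1 < ν) (x : ℝ) : 0 < normBesselSlope ν x :=
  div_pos (mul_pos (Real.Gamma_pos_of_pos (by linarith))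
    (besselSeries_pos (by linarith) (by positivity))) two_pos

lemma normBesselExt_zero (hν : -1 < ν) : normBesselExt ν 0 = 1 := by
  have : Real.Gamma (1 + ν) ≠ 0 := (Real.Gamma_pos_of_pos (by linarith)).ne'
  simp [normBesselExt, besselSeries_zero, this]

lemma hasDerivAt_sq_div_four (x : ℝ) : HasDerivAt (fun x : ℝ => x ^ 2 / 4) (x / 2) x := by
  refine ((hasDerivAt_pow 2 x).div_const 4).congr_deriv ?_
  norm_num
  ring

lemma hasDerivAt_normBesselExt (hν : -1 < ν) (x : ℝ) :
    HasDerivAt (normBesselExt ν) (x * normBesselSlope ν x) x := by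
  refine (((hasDerivAt_besselSeries hν (x ^ 2 / 4)).comp x
    (hasDerivAt_sq_div_four x)).const_mul (Real.Gamma (1 + ν))).congr_deriv ?_
  rw [normBesselSlope]
  ring

/-- This is Bessel's equation `f'' + (2ν+1) f'/x = f`, with `f'/x` replaced by the slope function so
that it is regular at `0`. It follows from the three-term recurrence at `z = x²/4`. -/
lemma hasDerivAt_mul_normBesselSlope (hν : -1 < ν) (x : ℝ) :
    HasDerivAt (fun x => x * normBesselSlope ν x)
      (normBesselExt ν x - (2 * ν + 1) * normBesselSlope ν x) x := by
  have h := (((hasDerivAt_besselSeries (show -1 < ν + 1 by linarith) (x ^ 2 / 4)).comp x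
    (hasDerivAt_sq_div_four x)).const_mul (Real.Gamma (1 + ν))).div_const 2
  refine ((hasDerivAt_id x).mul h).congr_deriv ?_
  rw [normBesselExt, normBesselSlope, besselSeries_recurrence hν]
  simp only [Function.comp, id]
  ring

lemma analyticAt_normBesselExt (hν : -1 < ν) (x : ℝ) : AnalyticAt ℝ (normBesselExt ν) x := by
  have h : AnalyticAt ℝ (fun x : ℝ => x ^ 2 / 4) x := by fun_prop
  exact analyticAt_const.mul (AnalyticAt.fun_comp (analyticAt_besselSeries hν (x ^ 2 / 4)) h)

lemma analyticAt_phaseExt (hν : -1 < ν) (x : ℝ) : AnalyticAt ℝ (phaseExt ν) x :=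
  analyticAt_id.sub ((analyticAt_normBesselExt hν x).log (normBesselExt_pos hν x))

lemma hasDerivAt_phaseExt (hν : -1 < ν) (x : ℝ) :
    HasDerivAt (phaseExt ν) (phaseDeriv ν x) x := by
  refine ((hasDerivAt_id x).sub ((hasDerivAt_normBesselExt hν x).log
    (normBesselExt_pos hν x).ne')).congr_deriv ?_
  rw [phaseDeriv, sub_div, div_self (normBesselExt_pos hν x).ne']

lemma hasDerivAt_phase (hν : -1 < ν) {x : ℝ} (hx : 0 < x) :
    HasDerivAt (phase ν) (phaseDeriv ν x) x :=
  (hasDerivAt_phaseExt hν x).congr_of_eventuallyEq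
    ((eventually_gt_nhds hx).mono fun _ hy => phase_eq_ext ν hy)

lemma phaseExt_zero (hν : -1 < ν) : phaseExt ν 0 = 0 := by
  simp [phaseExt, normBesselExt_zero hν]

lemma phaseDeriv_zero (hν : -1 < ν) : phaseDeriv ν 0 = 1 := by
  simp [phaseDeriv, normBesselExt_zero hν]

lemma phaseDeriv_le_one (hν : -1 < ν) {x : ℝ} (hx : 0 ≤ x) : phaseDeriv ν x ≤ 1 := by
  rw [phaseDeriv, div_le_one (normBesselExt_pos hν x)]
  have := mul_nonneg hx (normBesselSlope_pos hν x).le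
  linarith

end order_gt_neg_one

/-! ### Lower bounds for the phase, and its bijectivity -/

/-- If `g' + g ≥ 0` on `[0, ∞)` then `e ^ x g x ≥ g 0`. -/
lemma le_exp_mul_of_deriv_add_nonneg {g g' : ℝ → ℝ} (hg : ∀ x, HasDerivAt g (g' x) x)
    (h : ∀ x, 0 ≤ x → 0 ≤ g' x + g x) {x : ℝ} (hx : 0 ≤ x) : g 0 ≤ Real.exp x * g x := by
  have hd : ∀ x, HasDerivAt (fun x => Real.exp x * g x) (Real.exp x * g x + Real.exp x * g' x) x :=
    fun x => (Real.hasDerivAt_exp x).mul (hg x)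
  have hmono : MonotoneOn (fun x => Real.exp x * g x) (Ici 0) := by
    refine monotoneOn_of_deriv_nonneg (convex_Ici 0)
      (fun y _ => (hd y).continuousAt.continuousWithinAt)
      (fun y _ => (hd y).differentiableAt.differentiableWithinAt) fun y hy => ?_
    rw [interior_Ici] at hy
    rw [(hd y).deriv, ← mul_add, add_comm]
    exact mul_nonneg (Real.exp_pos y).le (h y (le_of_lt hy))
  simpa using hmono self_mem_Ici hx hx

/-- The exponent of a logarithmic lower bound for `phase ν`. -/
noncomputable def decayExponent (ν : ℝ) : ℝ := min 1 ((2 * ν + 1) / 2)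

lemma decayExponent_pos {ν : ℝ} (hν : -(1 / 2) < ν) : 0 < decayExponent ν :=
  lt_min one_pos (by linarith)

lemma hasDerivAt_normBesselExt_sub {ν : ℝ} (hν : -1 < ν) (x : ℝ) :
    HasDerivAt (fun x => normBesselExt ν x - x * normBesselSlope ν x)
      (-(normBesselExt ν x - x * normBesselSlope ν x) + (2 * ν + 1) * normBesselSlope ν x) x :=
  ((hasDerivAt_normBesselExt hν x).sub (hasDerivAt_mul_normBesselSlope hν x)).congr_deriv (by ring)

/-- The function `w = f - f'` satisfies `w' + w = (2ν+1) f'/x > 0` for `x > 0` and `w(0) = 1`, so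
`e^x w ≥ 1`. -/
lemma normBesselExt_sub_pos {ν : ℝ} (hν : -(1 / 2) < ν) {x : ℝ} (hx : 0 ≤ x) :
    0 < normBesselExt ν x - x * normBesselSlope ν x := by
  have h1 : -1 < ν := by linarith
  have h := le_exp_mul_of_deriv_add_nonneg (hasDerivAt_normBesselExt_sub h1) (fun y _ => by
    have := mul_pos (show 0 < 2 * ν + 1 by linarith) (normBesselSlope_pos h1 y)
    linarith) hx
  simp only [normBesselExt_zero h1, zero_mul, sub_zero] at h
  exact pos_of_mul_pos_right (one_pos.trans_le h) (Real.exp_pos x).le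

lemma phaseDeriv_pos {ν : ℝ} (hν : -(1 / 2) < ν) {x : ℝ} (hx : 0 ≤ x) : 0 < phaseDeriv ν x :=
  div_pos (normBesselExt_sub_pos hν hx) (normBesselExt_pos (by linarith) x)

/-- Since `ψ' = w/f` with `w = f - f'`, the claim is `(1+x) w - δ f ≥ 0`. The value at `0` is `1 -
δ`, which needs `δ ≤ 1`; the growth in `x` needs `2δ ≤ 2ν + 1`. These are the two bounds in the
minimum defining `δ`. -/
lemma decayExponent_div_le_phaseDeriv {ν : ℝ} (hν : -(1 / 2) < ν) {x : ℝ} (hx : 0 ≤ x) :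
    decayExponent ν / (1 + x) ≤ phaseDeriv ν x := by
  have h1 : -1 < ν := by linarith
  have hδ := decayExponent_pos hν
  have hδ1 : decayExponent ν ≤ 1 := min_le_left _ _
  have hδ2 : decayExponent ν ≤ (2 * ν + 1) / 2 := min_le_right _ _
  set δ := decayExponent ν
  have hd : ∀ x, HasDerivAt (fun x => (x + 1) * (normBesselExt ν x - x * normBesselSlope ν x) -
      δ * normBesselExt ν x)
      (1 * (normBesselExt ν x - x * normBesselSlope ν x) + (x + 1) *
        (-(normBesselExt ν x - x * normBesselSlope ν x) + (2 * ν + 1) * normBesselSlope ν x) -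
        δ * (x * normBesselSlope ν x)) x := fun x =>
    (((hasDerivAt_id x).add_const 1).mul (hasDerivAt_normBesselExt_sub h1 x)).sub
      ((hasDerivAt_normBesselExt h1 x).const_mul δ)
  -- With `s = f'/x` and `f = w + x s`, derivative plus function equals `(1-δ) w + ((2ν+1-2δ) x +
  -- (2ν+1)) s`; `e1` and `e2` are the two summands.
  have h := le_exp_mul_of_deriv_add_nonneg hd (fun y hy => by
    have hw := normBesselExt_sub_pos hν hy
    have hk := normBesselSlope_pos h1 y
    have e1 : 0 ≤ (1 - δ) * (normBesselExt ν y - y * normBesselSlope ν y) :=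
      mul_nonneg (by linarith) hw.le
    have e2 : 0 ≤ (((2 * ν + 1) - 2 * δ) * y + (2 * ν + 1)) * normBesselSlope ν y :=
      mul_nonneg (add_nonneg (mul_nonneg (by linarith) hy) (by linarith)) hk.le
    linarith) hx
  simp only [normBesselExt_zero h1, zero_mul, sub_zero, zero_add, mul_one] at h
  have h2 : 0 ≤ (x + 1) * (normBesselExt ν x - x * normBesselSlope ν x) -
      δ * normBesselExt ν x :=
    nonneg_of_mul_nonneg_right (by linarith) (Real.exp_pos x)
  rw [phaseDeriv, div_le_div_iff₀ (by linarith) (normBesselExt_pos h1 x)]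
  linarith

lemma decayExponent_mul_log_le_phaseExt {ν : ℝ} (hν : -(1 / 2) < ν) {x : ℝ} (hx : 0 ≤ x) :
    decayExponent ν * Real.log (1 + x) ≤ phaseExt ν x := by
  have h1 : -1 < ν := by linarith
  have hd : ∀ x, 0 ≤ x → HasDerivAt (fun x => phaseExt ν x - decayExponent ν * Real.log (1 + x))
      (phaseDeriv ν x - decayExponent ν * (1 / (1 + x))) x := fun x hx =>
    (hasDerivAt_phaseExt h1 x).sub
      ((((hasDerivAt_id x).const_add 1).log (by simp only [id]; linarith)).const_mul _)
  have hmono : MonotoneOn (fun x => phaseExt ν x - decayExponent ν * Real.log (1 + x)) (Ici 0) := by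
    refine monotoneOn_of_deriv_nonneg (convex_Ici 0)
      (fun y hy => (hd y hy).continuousAt.continuousWithinAt)
      (fun y hy => (hd y (interior_subset hy)).differentiableAt.differentiableWithinAt)
      fun y hy => ?_
    have hy0 := interior_subset hy
    rw [(hd y hy0).deriv, mul_one_div]
    exact sub_nonneg.2 (decayExponent_div_le_phaseDeriv hν hy0)
  have := hmono self_mem_Ici hx hx
  simp only [phaseExt_zero h1, add_zero, Real.log_one, mul_zero, sub_zero] at this
  linarith

lemma strictMonoOn_phaseExt {ν : ℝ} (hν : -(1 / 2) < ν) : StrictMonoOn (phaseExt ν) (Ici 0) := by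
  have hd := hasDerivAt_phaseExt (show -1 < ν by linarith)
  refine strictMonoOn_of_deriv_pos (convex_Ici 0)
    (fun y _ => (hd y).continuousAt.continuousWithinAt) fun y hy => ?_
  rw [(hd y).deriv]
  exact phaseDeriv_pos hν (interior_subset hy)

lemma phase_pos {ν : ℝ} (hν : -(1 / 2) < ν) {x : ℝ} (hx : 0 < x) : 0 < phase ν x := by
  rw [phase_eq_ext ν hx, ← phaseExt_zero (show -1 < ν by linarith)]
  exact strictMonoOn_phaseExt hν self_mem_Ici hx.le hx

lemma tendsto_phaseExt_atTop {ν : ℝ} (hν : -(1 / 2) < ν) : Tendsto (phaseExt ν) atTop atTop := by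
  refine tendsto_atTop_mono' _ ((eventually_ge_atTop 0).mono fun x hx =>
    decayExponent_mul_log_le_phaseExt hν hx) ?_
  exact (Real.tendsto_log_atTop.comp (tendsto_atTop_add_const_left _ 1 tendsto_id)).const_mul_atTop
    (decayExponent_pos hν)

lemma bijOn_phase {ν : ℝ} (hν : -(1 / 2) < ν) : BijOn (phase ν) (Ioi 0) (Ioi 0) := by
  refine ⟨fun x hx => phase_pos hν hx, fun x hx y hy hxy => ?_, fun τ hτ => ?_⟩
  · rw [phase_eq_ext ν hx, phase_eq_ext ν hy] at hxy
    exact (strictMonoOn_phaseExt hν).injOn (Ioi_subset_Ici_self hx) (Ioi_subset_Ici_self hy) hxy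
  · have h1 : -1 < ν := by linarith
    obtain ⟨b, hb, hb0⟩ := ((tendsto_phaseExt_atTop hν).eventually_ge_atTop τ |>.and
      (eventually_ge_atTop 0)).exists
    have hcont : ContinuousOn (phaseExt ν) (Icc 0 b) :=
      fun y _ => (hasDerivAt_phaseExt h1 y).continuousAt.continuousWithinAt
    obtain ⟨x, hx, hxτ⟩ := intermediate_value_Icc hb0 hcont
      ⟨(phaseExt_zero h1).le.trans (le_of_lt hτ), hb⟩
    have hx0 : 0 < x := hx.1.lt_of_ne (by
      rintro rfl
      rw [phaseExt_zero h1] at hxτ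
      exact (ne_of_lt hτ) hxτ)
    exact ⟨x, hx0, (phase_eq_ext ν hx0).trans hxτ⟩

/-! ### Decay and integrability of the integrand -/

/-- `(e^{-x} f(x))^n = e^{-n ψ(x)}`. -/
lemma besselIntegrand_eq {ν : ℝ} (hν : -1 < ν) (n : ℝ) {x : ℝ} (hx : 0 < x) :
    besselIntegrand ν n x = Real.exp (-n * phase ν x) := by
  have hp : 0 < normBesselI ν x := by rw [normBesselI_eq_ext ν hx]; exact normBesselExt_pos hν x
  rw [besselIntegrand, Real.rpow_def_of_pos (by positivity),
    Real.log_mul (Real.exp_pos _).ne' hp.ne', Real.log_exp, phase]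
  ring_nf

lemma exp_neg_mul_phase_le {ν : ℝ} (hν : -(1 / 2) < ν) {n : ℝ} (hn : 0 ≤ n) {x : ℝ} (hx : 0 < x) :
    Real.exp (-n * phase ν x) ≤ (1 + x) ^ (-(decayExponent ν * n)) := by
  rw [Real.rpow_def_of_pos (by linarith), Real.exp_le_exp, phase_eq_ext ν hx]
  nlinarith [decayExponent_mul_log_le_phaseExt hν hx.le]

lemma continuousOn_phase {ν : ℝ} (hν : -1 < ν) : ContinuousOn (phase ν) (Ioi 0) :=
  fun _ hx => (hasDerivAt_phase hν hx).continuousAt.continuousWithinAt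

/-- The integrand is integrable as soon as its decay exponent exceeds `1`. -/
lemma integrableOn_exp_neg_mul_phase_mul_pow {ν : ℝ} (hν : -(1 / 2) < ν) {n : ℝ} (m : ℕ)
    (hn : m + 1 < decayExponent ν * n) :
    IntegrableOn (fun x => x ^ m * Real.exp (-n * phase ν x)) (Ioi 0) := by
  have hm : (0 : ℝ) ≤ m := m.cast_nonneg
  have hn0 : 0 ≤ n := (pos_of_mul_pos_right (by linarith) (decayExponent_pos hν).le).le
  have h := integrableOn_add_rpow_Ioi_of_lt (a := m - decayExponent ν * n) (c := 0) (m := 1)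
    (by linarith) (by norm_num)
  refine Integrable.mono' h ?_ ?_
  · refine ContinuousOn.aestronglyMeasurable ?_ measurableSet_Ioi
    exact (continuousOn_pow m).mul
      (Real.continuous_exp.comp_continuousOn
        (continuousOn_const.mul (continuousOn_phase (by linarith))))
  · refine (ae_restrict_iff' measurableSet_Ioi).2 (Eventually.of_forall fun x hx => ?_)
    have hx : 0 < x := hx
    rw [Real.norm_of_nonneg (by positivity), add_comm x 1, sub_eq_add_neg,
      Real.rpow_add (by linarith), Real.rpow_natCast]
    gcongr
    · linarith
    · exact exp_neg_mul_phase_le hν hn0 hx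

/-! ### Watson's lemma -/

section watson

lemma integral_pow_mul_exp_neg_mul_Ioi (k : ℕ) {c : ℝ} (hc : 0 < c) :
    ∫ τ in Ioi (0 : ℝ), τ ^ k * Real.exp (-c * τ) = k ! / c ^ (k + 1) := by
  have h := Real.integral_rpow_mul_exp_neg_mul_Ioi (show (0 : ℝ) < (k + 1 : ℕ) by positivity) hc
  rw [Real.rpow_natCast] at h
  push_cast at h
  simp only [add_sub_cancel_right, Real.rpow_natCast, Real.Gamma_nat_eq_factorial] at h
  simp only [neg_mul]
  rw [h, one_div, inv_pow]
  ring

lemma integrableOn_pow_mul_exp_neg_mul_Ioi (k : ℕ) {c : ℝ} (hc : 0 < c) :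
    IntegrableOn (fun τ : ℝ => τ ^ k * Real.exp (-c * τ)) (Ioi 0) :=
  -- A non-integrable function has Bochner integral `0` by convention, so the nonzero value proves
  -- integrability.
  .of_integral_ne_zero (by rw [integral_pow_mul_exp_neg_mul_Ioi k hc]; positivity)

/-- A local polynomial approximation at `0+` of a function of exponential growth extends to a
bound on the half-line. -/
lemma exists_forall_abs_sub_le_of_isBigO {X : ℝ → ℝ} {K : ℝ} (hK : 0 ≤ K) {N : ℕ} {a : ℕ → ℝ}
    (hX : ∀ τ, 0 < τ → |X τ| ≤ Real.exp (K * τ))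
    (h0 : (fun τ => X τ - ∑ k ∈ Finset.range N, a k * τ ^ (k + 1)) =O[𝓝[>] 0]
      fun τ => τ ^ (N + 1)) :
    ∃ C, 0 ≤ C ∧ ∀ τ, 0 < τ → |X τ - ∑ k ∈ Finset.range N, a k * τ ^ (k + 1)| ≤
      C * (τ ^ (N + 1) * Real.exp (K * τ)) := by
  obtain ⟨c, hc, hcb⟩ := h0.exists_nonneg
  rw [isBigOWith_iff, eventually_nhdsWithin_iff, Metric.eventually_nhds_iff] at hcb
  obtain ⟨ε, hε, hcb⟩ := hcb
  -- `D` handles `τ ≥ ε`: there `τ/ε ≥ 1`, so each lower power of `τ/ε` is at most the power `N +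
  -- 1`.
  set D : ℝ := (1 + ∑ k ∈ Finset.range N, |a k| * ε ^ (k + 1)) / ε ^ (N + 1)
  have hD : 0 ≤ D := by positivity
  refine ⟨c + D, by positivity, fun τ hτ => ?_⟩
  have hexp : 1 ≤ Real.exp (K * τ) := Real.one_le_exp (by positivity)
  rcases lt_or_ge τ ε with h | h
  · have := hcb (by simpa [abs_of_pos hτ] using h) hτ
    rw [Real.norm_eq_abs, Real.norm_of_nonneg (by positivity)] at this
    refine this.trans ?_
    have h1 : c * τ ^ (N + 1) * 1 ≤ (c + D) * τ ^ (N + 1) * Real.exp (K * τ) := by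
      gcongr
      linarith
    linarith
  · have hq : 1 ≤ τ / ε := (one_le_div hε).2 h
    have h1 : |X τ| ≤ (τ / ε) ^ (N + 1) * Real.exp (K * τ) :=
      (hX τ hτ).trans (le_mul_of_one_le_left (Real.exp_pos _).le (one_le_pow₀ hq))
    have h2 : |∑ k ∈ Finset.range N, a k * τ ^ (k + 1)| ≤
        (∑ k ∈ Finset.range N, |a k| * ε ^ (k + 1)) * ((τ / ε) ^ (N + 1) * Real.exp (K * τ)) := by
      refine (Finset.abs_sum_le_sum_abs _ _).trans ?_
      rw [Finset.sum_mul]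
      refine Finset.sum_le_sum fun k hk => ?_
      have hk : k + 1 ≤ N + 1 := by have := Finset.mem_range.1 hk; omega
      have h3 : (τ / ε) ^ (k + 1) ≤ (τ / ε) ^ (N + 1) * Real.exp (K * τ) :=
        (pow_le_pow_right₀ hq hk).trans (le_mul_of_one_le_right (by positivity) hexp)
      calc |a k * τ ^ (k + 1)| = |a k| * ε ^ (k + 1) * (τ / ε) ^ (k + 1) := by
            rw [abs_mul, abs_of_nonneg (by positivity : 0 ≤ τ ^ (k + 1)), mul_assoc, ← mul_pow,
              mul_div_cancel₀ _ hε.ne']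
        _ ≤ _ := by gcongr
    calc |X τ - ∑ k ∈ Finset.range N, a k * τ ^ (k + 1)|
        ≤ |X τ| + |∑ k ∈ Finset.range N, a k * τ ^ (k + 1)| := abs_sub _ _
      _ ≤ D * (τ ^ (N + 1) * Real.exp (K * τ)) := by
          refine (add_le_add h1 h2).trans (le_of_eq ?_)
          simp only [D, div_pow]
          ring
      _ ≤ _ := by
          gcongr
          linarith

/-- **Watson's lemma** for `n ∫ e^{-nτ} X(τ) dτ` with a function `X` of exponential growth. -/
lemma watson_isBigO {X : ℝ → ℝ} {K : ℝ} (hK : 0 ≤ K) {N : ℕ} {a : ℕ → ℝ}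
    (hint : ∀ᶠ n : ℝ in atTop, IntegrableOn (fun τ => X τ * Real.exp (-n * τ)) (Ioi 0))
    (hX : ∀ τ, 0 < τ → |X τ| ≤ Real.exp (K * τ))
    (h0 : (fun τ => X τ - ∑ k ∈ Finset.range N, a k * τ ^ (k + 1)) =O[𝓝[>] 0]
      fun τ => τ ^ (N + 1)) :
    (fun n : ℝ => n * (∫ τ in Ioi (0 : ℝ), X τ * Real.exp (-n * τ)) -
      ∑ k ∈ Finset.range N, ((k + 1)! : ℝ) * a k / n ^ (k + 1)) =O[atTop]
      fun n : ℝ => 1 / n ^ (N + 1) := by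
  obtain ⟨C, hC, hb⟩ := exists_forall_abs_sub_le_of_isBigO hK hX h0
  -- The remainder integrates to `C (N+1)!/(n-K)^{N+2}`. For `n ≥ 2K` one has `n - K ≥ n/2`, whence
  -- the factor `2^{N+2}`; the prefactor `n` removes one power.
  refine IsBigO.of_bound (C * (N + 1)! * 2 ^ (N + 2)) ?_
  filter_upwards [hint, eventually_gt_atTop 0, eventually_ge_atTop (2 * K)] with n hn hn0 hnK
  have hterm : ∀ k ∈ Finset.range N, IntegrableOn
      (fun τ : ℝ => a k * (τ ^ (k + 1) * Real.exp (-n * τ))) (Ioi 0) := fun k _ =>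
    (integrableOn_pow_mul_exp_neg_mul_Ioi (k + 1) hn0).const_mul _
  have hsum : n * (∫ τ in Ioi (0 : ℝ), X τ * Real.exp (-n * τ)) -
      ∑ k ∈ Finset.range N, ((k + 1)! : ℝ) * a k / n ^ (k + 1) =
      n * ∫ τ in Ioi (0 : ℝ), (X τ * Real.exp (-n * τ) -
        ∑ k ∈ Finset.range N, a k * (τ ^ (k + 1) * Real.exp (-n * τ))) := by
    rw [integral_sub hn (integrable_finsetSum _ hterm), integral_finsetSum _ hterm, mul_sub,
      Finset.mul_sum]
    congr 1
    refine Finset.sum_congr rfl fun k _ => ?_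
    rw [integral_const_mul, integral_pow_mul_exp_neg_mul_Ioi _ hn0]
    field_simp
    ring
  have hnK' : 0 < n - K := by linarith
  have hbound : ‖∫ τ in Ioi (0 : ℝ), (X τ * Real.exp (-n * τ) -
        ∑ k ∈ Finset.range N, a k * (τ ^ (k + 1) * Real.exp (-n * τ)))‖ ≤
      C * ((N + 1)! / (n - K) ^ (N + 1 + 1)) := by
    rw [← integral_pow_mul_exp_neg_mul_Ioi (N + 1) hnK', ← integral_const_mul]
    refine norm_integral_le_of_norm_le
      ((integrableOn_pow_mul_exp_neg_mul_Ioi (N + 1) hnK').const_mul C) ?_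
    refine (ae_restrict_iff' measurableSet_Ioi).2 (Eventually.of_forall fun τ hτ => ?_)
    have he : Real.exp (-(n - K) * τ) = Real.exp (K * τ) * Real.exp (-n * τ) := by
      rw [← Real.exp_add]
      ring_nf
    have hfac : X τ * Real.exp (-n * τ) -
        ∑ k ∈ Finset.range N, a k * (τ ^ (k + 1) * Real.exp (-n * τ)) =
        (X τ - ∑ k ∈ Finset.range N, a k * τ ^ (k + 1)) * Real.exp (-n * τ) := by
      simp only [sub_mul, Finset.sum_mul, mul_assoc]
    rw [hfac, norm_mul, Real.norm_of_nonneg (Real.exp_pos _).le, Real.norm_eq_abs, he]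
    have := mul_le_mul_of_nonneg_right (hb τ hτ) (Real.exp_pos (-n * τ)).le
    linarith
  rw [hsum, norm_mul, Real.norm_of_nonneg hn0.le,
    Real.norm_of_nonneg (show 0 ≤ 1 / n ^ (N + 1) by positivity)]
  calc n * ‖_‖ ≤ n * (C * ((N + 1)! / (n - K) ^ (N + 1 + 1))) := by gcongr
    _ ≤ n * (C * ((N + 1)! / (n / 2) ^ (N + 1 + 1))) := by
        gcongr
        linarith
    _ = _ := by
        rw [div_pow]
        field_simp
        ring

end watson

/-! ### The inverse phase and the substitution `τ = ψ(x)` -/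

section phaseInv

variable {ν : ℝ}

lemma phaseInv_pos (hν : -(1 / 2) < ν) {τ : ℝ} (hτ : 0 < τ) : 0 < phaseInv ν τ :=
  Function.invFunOn_mem ((bijOn_phase hν).surjOn hτ)

lemma phase_phaseInv (hν : -(1 / 2) < ν) {τ : ℝ} (hτ : 0 < τ) : phase ν (phaseInv ν τ) = τ :=
  Function.invFunOn_eq ((bijOn_phase hν).surjOn hτ)

lemma phaseInv_phase (hν : -(1 / 2) < ν) {x : ℝ} (hx : 0 < x) : phaseInv ν (phase ν x) = x :=
  (bijOn_phase hν).injOn (phaseInv_pos hν (phase_pos hν hx)) hx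
    (phase_phaseInv hν (phase_pos hν hx))

/-- Solve `δ log(1+x) ≤ ψ(x) = τ` for `x`. The bound supplies both the growth condition in Watson's
lemma and the limit `x(τ) → 0`. -/
lemma one_add_phaseInv_le (hν : -(1 / 2) < ν) {τ : ℝ} (hτ : 0 < τ) :
    1 + phaseInv ν τ ≤ Real.exp ((decayExponent ν)⁻¹ * τ) := by
  have hx := phaseInv_pos hν hτ
  have hδ := decayExponent_pos hν
  have h := decayExponent_mul_log_le_phaseExt hν hx.le
  rw [← phase_eq_ext ν hx, phase_phaseInv hν hτ] at h
  have h1 : Real.log (1 + phaseInv ν τ) ≤ (decayExponent ν)⁻¹ * τ := by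
    rw [inv_mul_eq_div, le_div_iff₀ hδ]
    linarith
  rwa [Real.log_le_iff_le_exp (by linarith)] at h1

lemma abs_phaseInv_le (hν : -(1 / 2) < ν) {τ : ℝ} (hτ : 0 < τ) :
    |phaseInv ν τ| ≤ Real.exp ((decayExponent ν)⁻¹ * τ) := by
  rw [abs_of_pos (phaseInv_pos hν hτ)]
  linarith [one_add_phaseInv_le hν hτ]

lemma tendsto_phaseInv (hν : -(1 / 2) < ν) : Tendsto (phaseInv ν) (𝓝[>] 0) (𝓝[>] 0) := by
  refine tendsto_nhdsWithin_iff.2 ⟨?_, eventually_mem_nhdsWithin.mono fun τ hτ =>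
    phaseInv_pos hν hτ⟩
  have hc : Continuous fun τ => Real.exp ((decayExponent ν)⁻¹ * τ) - 1 := by fun_prop
  have ht : Tendsto (fun τ => Real.exp ((decayExponent ν)⁻¹ * τ) - 1) (𝓝[>] 0) (𝓝 0) := by
    simpa using (hc.tendsto 0).mono_left nhdsWithin_le_nhds
  refine squeeze_zero' (eventually_mem_nhdsWithin.mono fun τ hτ => (phaseInv_pos hν hτ).le)
    (eventually_mem_nhdsWithin.mono fun τ hτ => ?_) ht
  linarith [one_add_phaseInv_le hν hτ]

lemma abs_phaseDeriv_smul_eq (hν : -(1 / 2) < ν) (n : ℝ) {x : ℝ} (hx : 0 < x) :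
    |phaseDeriv ν x| • (phaseInv ν (phase ν x) * Real.exp (-n * phase ν x)) =
      x * (phaseDeriv ν x * Real.exp (-n * phase ν x)) := by
  rw [abs_of_pos (phaseDeriv_pos hν hx.le), phaseInv_phase hν hx, smul_eq_mul]
  ring

/-- As `0 < ψ' ≤ 1`, the integrand is dominated by `x e^{-nψ}`; the extra factor `x` is why the
decay exponent must exceed `2`. -/
lemma integrableOn_mul_phaseDeriv_mul_exp (hν : -(1 / 2) < ν) {n : ℝ}
    (hn : 2 < decayExponent ν * n) :
    IntegrableOn (fun x => x * (phaseDeriv ν x * Real.exp (-n * phase ν x))) (Ioi 0) := by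
  have h1 : -1 < ν := by linarith
  have hcont : ContinuousOn (phaseDeriv ν) (Ioi 0) := by
    have : phaseDeriv ν = deriv (phaseExt ν) := funext fun x => (hasDerivAt_phaseExt h1 x).deriv.symm
    rw [this]
    exact fun x _ => (analyticAt_phaseExt h1 x).deriv.continuousAt.continuousWithinAt
  refine Integrable.mono' (integrableOn_exp_neg_mul_phase_mul_pow hν (n := n) 1
    (by norm_num; linarith)) ?_ ?_
  · refine ContinuousOn.aestronglyMeasurable ?_ measurableSet_Ioi
    exact continuousOn_id.mul (hcont.mul
      (Real.continuous_exp.comp_continuousOn (continuousOn_const.mul (continuousOn_phase h1))))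
  · refine (ae_restrict_iff' measurableSet_Ioi).2 (Eventually.of_forall fun x hx => ?_)
    have hx : 0 < x := hx
    have hp := phaseDeriv_pos hν hx.le
    rw [Real.norm_of_nonneg (by positivity), pow_one]
    gcongr
    exact mul_le_of_le_one_left (Real.exp_pos _).le (phaseDeriv_le_one h1 hx.le)

lemma integrableOn_phaseInv_mul_exp (hν : -(1 / 2) < ν) {n : ℝ} (hn : 2 < decayExponent ν * n) :
    IntegrableOn (fun τ => phaseInv ν τ * Real.exp (-n * τ)) (Ioi 0) := by
  have hd : ∀ x ∈ Ioi (0 : ℝ), HasDerivWithinAt (phase ν) (phaseDeriv ν x) (Ioi 0) x :=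
    fun x hx => (hasDerivAt_phase (by linarith) hx).hasDerivWithinAt
  have hbij := bijOn_phase hν
  rw [← hbij.image_eq, integrableOn_image_iff_integrableOn_abs_deriv_smul measurableSet_Ioi hd
    hbij.injOn]
  exact (integrableOn_mul_phaseDeriv_mul_exp hν hn).congr_fun
    (fun x hx => (abs_phaseDeriv_smul_eq hν n hx).symm) measurableSet_Ioi

lemma integral_phaseInv_mul_exp (hν : -(1 / 2) < ν) (n : ℝ) :
    ∫ τ in Ioi (0 : ℝ), phaseInv ν τ * Real.exp (-n * τ) =
      ∫ x in Ioi (0 : ℝ), x * (phaseDeriv ν x * Real.exp (-n * phase ν x)) := by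
  have hd : ∀ x ∈ Ioi (0 : ℝ), HasDerivWithinAt (phase ν) (phaseDeriv ν x) (Ioi 0) x :=
    fun x hx => (hasDerivAt_phase (by linarith) hx).hasDerivWithinAt
  have hbij := bijOn_phase hν
  have h := integral_image_eq_integral_abs_deriv_smul measurableSet_Ioi hd hbij.injOn
    (fun τ => phaseInv ν τ * Real.exp (-n * τ))
  rw [hbij.image_eq] at h
  rw [h]
  exact setIntegral_congr_fun measurableSet_Ioi fun x hx => abs_phaseDeriv_smul_eq hν n hx

/-- Integration by parts followed by the substitution `τ = ψ(x)`. -/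
lemma besselIntegral_eq (hν : -(1 / 2) < ν) {n : ℝ} (hn : 2 < decayExponent ν * n) :
    besselIntegral ν n = n * ∫ τ in Ioi (0 : ℝ), phaseInv ν τ * Real.exp (-n * τ) := by
  have h1 : -1 < ν := by linarith
  have hn0 : 0 ≤ n := (pos_of_mul_pos_right (by linarith) (decayExponent_pos hν).le).le
  have hv : ∀ x ∈ Ioi (0 : ℝ), HasDerivAt (fun x => Real.exp (-n * phase ν x))
      (Real.exp (-n * phase ν x) * (-n * phaseDeriv ν x)) x := fun x hx =>
    ((hasDerivAt_phase h1 hx).const_mul (-n)).exp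
  have hint := integrableOn_exp_neg_mul_phase_mul_pow hν (n := n) 0 (by norm_num; linarith)
  simp only [pow_zero, one_mul] at hint
  have heq : (fun x => x * (Real.exp (-n * phase ν x) * (-n * phaseDeriv ν x))) =
      fun x => -n * (x * (phaseDeriv ν x * Real.exp (-n * phase ν x))) := by
    funext x
    ring
  have hbd : ∀ x, 0 < x → |x * Real.exp (-n * phase ν x)| ≤
      (1 + x) ^ (1 - decayExponent ν * n) := by
    intro x hx
    rw [abs_of_nonneg (by positivity), sub_eq_add_neg, Real.rpow_add (by linarith), Real.rpow_one]
    gcongr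
    · linarith
    · exact exp_neg_mul_phase_le hν hn0 hx
  have h0 : Tendsto (fun x => x * Real.exp (-n * phase ν x)) (𝓝[>] 0) (𝓝 0) := by
    refine squeeze_zero' (g := fun x => x) ?_ ?_ (tendsto_id.mono_left nhdsWithin_le_nhds)
    · filter_upwards [self_mem_nhdsWithin] with x hx
      exact mul_nonneg (le_of_lt hx) (Real.exp_pos _).le
    · filter_upwards [self_mem_nhdsWithin] with x hx
      refine mul_le_of_le_one_right (le_of_lt hx) (Real.exp_le_one_iff.2 ?_)
      nlinarith [phase_pos hν hx]
  have hinf : Tendsto (fun x => x * Real.exp (-n * phase ν x)) atTop (𝓝 0) := by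
    refine squeeze_zero_norm' (a := fun x => (1 + x) ^ (-(decayExponent ν * n - 1))) ?_ ?_
    · filter_upwards [eventually_gt_atTop 0] with x hx
      rw [Real.norm_eq_abs, neg_sub]
      exact hbd x hx
    · exact (tendsto_rpow_neg_atTop (by linarith)).comp
        (tendsto_atTop_add_const_left _ 1 tendsto_id)
  -- Both boundary values of `x e^{-nψ}` vanish: at `0` because of the factor `x`, at infinity
  -- because `δn > 1`.
  have hparts := integral_Ioi_mul_deriv_eq_deriv_mul (a := 0) (u := fun x => x)
    (v := fun x => Real.exp (-n * phase ν x)) (u' := fun _ => 1) (a' := 0) (b' := 0)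
    (fun x _ => hasDerivAt_id x) hv
    (by
      change IntegrableOn (fun x => x * (Real.exp (-n * phase ν x) * (-n * phaseDeriv ν x))) _
      rw [heq]
      exact (integrableOn_mul_phaseDeriv_mul_exp hν hn).const_mul _)
    (by
      change IntegrableOn (fun x => 1 * Real.exp (-n * phase ν x)) _
      simpa using hint)
    h0 hinf
  rw [heq, integral_const_mul] at hparts
  simp only [one_mul, sub_zero, zero_sub] at hparts
  rw [integral_phaseInv_mul_exp hν, besselIntegral,
    setIntegral_congr_fun measurableSet_Ioi fun x hx => besselIntegrand_eq h1 n hx]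
  linarith

/-- A polynomial approximation of the inverse phase at `0+` yields the asymptotics of the
integral. -/
lemma besselIntegral_isBigO (hν : -(1 / 2) < ν) {N : ℕ} {a : ℕ → ℝ}
    (h0 : (fun τ => phaseInv ν τ - ∑ k ∈ Finset.range N, a k * τ ^ (k + 1)) =O[𝓝[>] 0]
      fun τ => τ ^ (N + 1)) :
    (fun n : ℝ => besselIntegral ν n -
      ∑ k ∈ Finset.range N, ((k + 1)! : ℝ) * a k / n ^ (k + 1)) =O[atTop]
      fun n : ℝ => 1 / n ^ (N + 1) := by
  have hδ := decayExponent_pos hν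
  have hlarge : ∀ᶠ n : ℝ in atTop, 2 < decayExponent ν * n :=
    (tendsto_id.const_mul_atTop hδ).eventually_gt_atTop 2
  refine (watson_isBigO (inv_nonneg.2 hδ.le)
    (hlarge.mono fun n hn => integrableOn_phaseInv_mul_exp hν hn)
    (fun τ hτ => abs_phaseInv_le hν hτ) h0).congr' ?_ EventuallyEq.rfl
  filter_upwards [hlarge] with n hn
  rw [besselIntegral_eq hν hn]

end phaseInv

/-! ### Analyticity of the inverse at the origin -/

section analytic_inverse

variable {ν : ℝ}

/-- The inverse phase agrees near `0+` with a function analytic at `0`. -/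
lemma exists_analyticAt_phaseInv (hν : -(1 / 2) < ν) :
    ∃ g : ℝ → ℝ, AnalyticAt ℝ g 0 ∧ g 0 = 0 ∧ phaseInv ν =ᶠ[𝓝[>] 0] g := by
  have h1 : -1 < ν := by linarith
  have hf := analyticAt_phaseExt h1 0
  have hf' : deriv (phaseExt ν) 0 ≠ 0 := by
    rw [(hasDerivAt_phaseExt h1 0).deriv, phaseDeriv_zero h1]
    exact one_ne_zero
  have hleft := hf.hasStrictDerivAt.eventually_left_inverse hf'
  have han := hf.analyticAt_localInverse hf'
  rw [phaseExt_zero h1] at han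
  refine ⟨_, han, ?_, ?_⟩
  · simpa only [phaseExt_zero h1] using hleft.self_of_nhds
  · have ht : Tendsto (phaseInv ν) (𝓝[>] 0) (𝓝 0) :=
      (tendsto_phaseInv hν).mono_right nhdsWithin_le_nhds
    -- Since `x(τ) → 0`, the point `x(τ)` eventually lies where the local inverse undoes `ψ`, which
    -- identifies the global inverse with the local one.
    filter_upwards [ht.eventually hleft, self_mem_nhdsWithin] with τ hτ hτ0
    rw [← phase_eq_ext ν (phaseInv_pos hν hτ0), phase_phaseInv hν hτ0] at hτ
    exact hτ.symm

/-- This converts errors `O(x^8)` into errors `O(τ^8)`. -/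
lemma phaseInv_isBigO (hν : -(1 / 2) < ν) : phaseInv ν =O[𝓝[>] 0] fun τ => τ := by
  obtain ⟨g, hg, h0, heq⟩ := exists_analyticAt_phaseInv hν
  have h := hg.differentiableAt.isBigO_sub
  simp only [h0, sub_zero] at h
  exact (h.mono nhdsWithin_le_nhds).congr' heq.symm EventuallyEq.rfl

/-- Taylor's formula for a function analytic at `0` and vanishing there. -/
lemma isBigO_sub_sum_iteratedDeriv {g : ℝ → ℝ} (hg : AnalyticAt ℝ g 0) (h0 : g 0 = 0) (N : ℕ) :
    (fun τ => g τ - ∑ k ∈ Finset.range N, iteratedDeriv (k + 1) g 0 / (k + 1)! * τ ^ (k + 1))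
      =O[𝓝 0] fun τ => τ ^ (N + 1) := by
  have h := hg.hasFPowerSeriesAt.isBigO_sub_partialSum_pow (N + 1)
  rw [← isBigO_norm_right]
  simpa [FormalMultilinearSeries.partialSum, Finset.sum_range_succ', h0, mul_comm] using h

/-- The derivative of an analytic function is the sum of its Taylor series near `0`. -/
lemma exists_hasSum_deriv {g : ℝ → ℝ} (hg : AnalyticAt ℝ g 0) :
    ∃ r > 0, ∀ τ : ℝ, |τ| < r → HasDerivAt g (deriv g τ) τ ∧
      HasSum (fun k : ℕ => iteratedDeriv (k + 1) g 0 / k ! * τ ^ k) (deriv g τ) := by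
  have h := hg.deriv.hasFPowerSeriesAt.eventually_hasSum
  obtain ⟨r, hr, hb⟩ := Metric.eventually_nhds_iff.1 (h.and hg.eventually_analyticAt)
  refine ⟨r, hr, fun τ hτ => ?_⟩
  obtain ⟨hs, ha⟩ := hb (show dist τ 0 < r by simpa using hτ)
  refine ⟨ha.differentiableAt.hasDerivAt, ?_⟩
  simpa [iteratedDeriv_succ', mul_comm] using hs

/-- The Taylor coefficients of the analytic inverse are inversion coefficients. -/
lemma isInversionCoeff_of_analyticAt {g : ℝ → ℝ} (hg : AnalyticAt ℝ g 0)
    (heq : phaseInv ν =ᶠ[𝓝[>] 0] g) :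
    IsInversionCoeff ν fun k => iteratedDeriv (k + 1) g 0 / k ! := by
  obtain ⟨r, hr, hs⟩ := exists_hasSum_deriv hg
  obtain ⟨u, hu, hsub⟩ := mem_nhdsGT_iff_exists_Ioo_subset.1 heq
  refine ⟨min r u, lt_min hr hu, fun τ hτ => ⟨deriv g τ, ?_⟩⟩
  obtain ⟨hd, hsum⟩ := hs τ (by
    rw [abs_of_pos hτ.1]
    exact hτ.2.trans_le (min_le_left _ _))
  refine ⟨hd.congr_of_eventuallyEq ?_, hsum⟩
  filter_upwards [Ioo_mem_nhds hτ.1 (hτ.2.trans_le (min_le_right _ _))] with y hy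
  exact hsub hy

end analytic_inverse

/-! ### The first seven coefficients -/

section expansion

lemma isBigO_pow_mul_of_continuous {R : ℝ → ℝ} (hR : Continuous R) (m : ℕ) :
    (fun x => x ^ m * R x) =O[𝓝 0] fun x => x ^ m := by
  have h : R =O[𝓝 0] fun _ => (1 : ℝ) := (hR.tendsto 0).isBigO_one ℝ
  simpa using (isBigO_refl (fun x : ℝ => x ^ m) (𝓝 0)).mul h

/-- Third order expansion of the logarithm of an even function. -/
lemma log_sub_isBigO {f : ℝ → ℝ} {α β γ : ℝ}
    (hf : (fun x => f x - (1 + (α * x ^ 2 + β * x ^ 4 + γ * x ^ 6))) =O[𝓝 0] fun x => x ^ 8)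
    (hf1 : Tendsto f (𝓝 0) (𝓝 1)) :
    (fun x => Real.log (f x) - (α * x ^ 2 + (β - α ^ 2 / 2) * x ^ 4 +
      (γ - α * β + α ^ 3 / 3) * x ^ 6)) =O[𝓝 0] fun x => x ^ 8 := by
  set P : ℝ → ℝ := fun x => α * x ^ 2 + β * x ^ 4 + γ * x ^ 6
  have hPc : Continuous P := by fun_prop
  have hP0 : Tendsto P (𝓝 0) (𝓝 0) := by simpa [P] using hPc.tendsto 0
  have hP1 : Tendsto (fun x => 1 + P x) (𝓝 0) (𝓝 1) := by simpa using hP0.const_add 1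
  -- Strict differentiability makes `log` Lipschitz near `1`, so the error of `f` passes to `log f`.
  have e1 : (fun x => Real.log (f x) - Real.log (1 + P x)) =O[𝓝 0] fun x => x ^ 8 :=
    ((Real.hasStrictDerivAt_log one_ne_zero).hasStrictFDerivAt.isBigO_sub.comp_tendsto
      (hf1.prodMk_nhds hP1)).trans hf
  have hP2 : P =O[𝓝 0] fun x => x ^ 2 := by
    refine (isBigO_pow_mul_of_continuous (R := fun x => α + β * x ^ 2 + γ * x ^ 4)
      (by fun_prop) 2).congr_left fun x => ?_
    simp only [P]
    ring
  have e2 : (fun x => Real.log (1 + P x) - (P x - P x ^ 2 / 2 + P x ^ 3 / 3)) =O[𝓝 0]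
      fun x => x ^ 8 := by
    have h := (hasFPowerSeriesAt_log_one_add.isBigO_sub_partialSum_pow 4).comp_tendsto hP0
    have h4 : (fun x => ‖P x‖ ^ 4) =O[𝓝 0] fun x => x ^ 8 := by
      refine ((hP2.norm_left.pow 4)).congr_right fun x => by ring
    refine (h.trans h4).congr_left fun x => ?_
    simp [FormalMultilinearSeries.partialSum, Finset.sum_range_succ]
    ring
  have e3 : (fun x => (P x - P x ^ 2 / 2 + P x ^ 3 / 3) - (α * x ^ 2 + (β - α ^ 2 / 2) * x ^ 4 +
      (γ - α * β + α ^ 3 / 3) * x ^ 6)) =O[𝓝 0] fun x => x ^ 8 := by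
    refine (isBigO_pow_mul_of_continuous (R := fun x =>
      -((β ^ 2 + 2 * α * γ) + 2 * β * γ * x ^ 2 + γ ^ 2 * x ^ 4) / 2 +
      (3 * α ^ 2 * β + (3 * α * β ^ 2 + 3 * α ^ 2 * γ) * x ^ 2 + (β ^ 3 + 6 * α * β * γ) * x ^ 4 +
        (3 * β ^ 2 * γ + 3 * α * γ ^ 2) * x ^ 6 + 3 * β * γ ^ 2 * x ^ 8 + γ ^ 3 * x ^ 10) / 3)
      (by fun_prop) 8).congr_left fun x => ?_
    simp only [P]
    ring
  exact ((e1.add e2).add e3).congr_left fun x => by ring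

/-- Reversion of the series `y = x - a x² - b x⁴ - c x⁶` up to order seven. -/
lemma reversion_sub_isBigO {y : ℝ → ℝ} {a b c : ℝ}
    (hy : (fun x => y x - (x - a * x ^ 2 - b * x ^ 4 - c * x ^ 6)) =O[𝓝 0] fun x => x ^ 8)
    (hy0 : Tendsto y (𝓝 0) (𝓝 0)) :
    (fun x => x - (y x + a * y x ^ 2 + 2 * a ^ 2 * y x ^ 3 + (b + 5 * a ^ 3) * y x ^ 4 +
      (6 * a * b + 14 * a ^ 4) * y x ^ 5 + (c + 28 * a ^ 2 * b + 42 * a ^ 5) * y x ^ 6 +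
      (4 * b ^ 2 + 8 * a * c + 120 * a ^ 3 * b + 132 * a ^ 6) * y x ^ 7)) =O[𝓝 0]
      fun x => x ^ 8 := by
  -- `Q` is the truncated compositional inverse of `P`; for `b = c = 0` its coefficients are Catalan
  -- numbers times powers of `a`.
  set Q : ℝ → ℝ := fun y => y + a * y ^ 2 + 2 * a ^ 2 * y ^ 3 + (b + 5 * a ^ 3) * y ^ 4 +
      (6 * a * b + 14 * a ^ 4) * y ^ 5 + (c + 28 * a ^ 2 * b + 42 * a ^ 5) * y ^ 6 +
      (4 * b ^ 2 + 8 * a * c + 120 * a ^ 3 * b + 132 * a ^ 6) * y ^ 7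
  set P : ℝ → ℝ := fun x => x - a * x ^ 2 - b * x ^ 4 - c * x ^ 6
  have hPc : Continuous P := by fun_prop
  have hP0 : Tendsto P (𝓝 0) (𝓝 0) := by simpa [P] using hPc.tendsto 0
  have hQ : AnalyticAt ℝ Q 0 := by fun_prop
  have e1 : (fun x => Q (P x) - Q (y x)) =O[𝓝 0] fun x => x ^ 8 :=
    (hQ.hasStrictDerivAt.hasStrictFDerivAt.isBigO_sub.comp_tendsto
      (hP0.prodMk_nhds hy0)).trans ((hy.neg_left).congr_left fun x => by
        simp only [Function.comp, neg_sub]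
        rfl)
  -- `R_j` is the cofactor of `x^8` in the part of `P^{j+1}` of degree at least `8`. It is built
  -- recursively: multiply by `P` and add the overflow from the lower part.
  set R₁ : ℝ → ℝ := fun x =>
    b ^ 2 + 2 * a * c + 2 * x ^ 2 * b * c + x ^ 4 * c ^ 2
  set R₂ : ℝ → ℝ := fun x => P x * R₁ x +
    (-3 * c - 3 * a ^ 2 * b + 2 * x * b ^ 2 + 4 * x * a * c - 2 * x ^ 2 * a * b ^ 2 -
      x ^ 2 * a ^ 2 * c + 4 * x ^ 3 * b * c - 2 * x ^ 4 * a * b * c + 2 * x ^ 5 * c ^ 2)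
  set R₃ : ℝ → ℝ := fun x => P x * R₂ x +
    (12 * a * b + a ^ 4 - x * c - 9 * x * a ^ 2 * b + 3 * x ^ 2 * b ^ 2 + 3 * x ^ 2 * a * c +
      x ^ 2 * a ^ 3 * b - 6 * x ^ 3 * a * b ^ 2 - 3 * x ^ 3 * a ^ 2 * c + 3 * x ^ 4 * b * c +
      x ^ 4 * a ^ 3 * c - 6 * x ^ 5 * a * b * c)
  set R₄ : ℝ → ℝ := fun x => P x * R₃ x +
    (-5 * b - 10 * a ^ 3 + 8 * x * a * b + 4 * x * a ^ 4 - x ^ 2 * c - 6 * x ^ 2 * a ^ 2 * b +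
      4 * x ^ 3 * b ^ 2 + 4 * x ^ 3 * a * c + 4 * x ^ 3 * a ^ 3 * b - 6 * x ^ 4 * a ^ 2 * c +
      4 * x ^ 5 * b * c + 4 * x ^ 5 * a ^ 3 * c)
  set R₅ : ℝ → ℝ := fun x => P x * R₄ x +
    (15 * a ^ 2 - x * b - 10 * x * a ^ 3 + 5 * x ^ 2 * a * b - x ^ 3 * c - 10 * x ^ 3 * a ^ 2 * b +
      5 * x ^ 4 * a * c - 10 * x ^ 5 * a ^ 2 * c)
  set R₆ : ℝ → ℝ := fun x => P x * R₅ x +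
    (-7 * a + 6 * x * a ^ 2 - x ^ 2 * b + 6 * x ^ 3 * a * b - x ^ 4 * c + 6 * x ^ 5 * a * c)
  have e2 : (fun x => x - Q (P x)) =O[𝓝 0] fun x => x ^ 8 := by
    refine (isBigO_pow_mul_of_continuous (R := fun x => -(a * R₁ x + 2 * a ^ 2 * R₂ x +
      (b + 5 * a ^ 3) * R₃ x + (6 * a * b + 14 * a ^ 4) * R₄ x +
      (c + 28 * a ^ 2 * b + 42 * a ^ 5) * R₅ x +
      (4 * b ^ 2 + 8 * a * c + 120 * a ^ 3 * b + 132 * a ^ 6) * R₆ x))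
      (by fun_prop) 8).congr_left fun x => ?_
    simp only [Q, R₁, R₂, R₃, R₄, R₅, R₆, P]
    ring
  exact (e2.add e1).congr_left fun x => by ring

lemma normBesselExt_sub_isBigO {ν : ℝ} (hν : -1 < ν) :
    (fun x => normBesselExt ν x - (1 + (1 / (4 * (ν + 1)) * x ^ 2 +
      1 / (32 * (ν + 1) * (ν + 2)) * x ^ 4 +
      1 / (384 * (ν + 1) * (ν + 2) * (ν + 3)) * x ^ 6))) =O[𝓝 0] fun x => x ^ 8 := by
  have hz : Tendsto (fun x : ℝ => x ^ 2 / 4) (𝓝 0) (𝓝 0) := by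
    simpa using (hasDerivAt_sq_div_four 0).continuousAt.tendsto
  have h := ((hasFPowerSeriesOnBall_besselSeries hν).hasFPowerSeriesAt.isBigO_sub_partialSum_pow
    4).comp_tendsto hz
  have h8 : (fun x : ℝ => ‖x ^ 2 / 4‖ ^ 4) =O[𝓝 0] fun x => x ^ 8 := by
    refine (isBigO_pow_mul_of_continuous (R := fun _ => 1 / 256) (by fun_prop) 8).congr_left
      fun x => ?_
    rw [Real.norm_of_nonneg (by positivity)]
    ring
  refine ((h.trans h8).const_mul_left (Real.Gamma (1 + ν))).congr_left fun x => ?_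
  have hc0 : Real.Gamma (1 + ν) * besselCoeff ν 0 = 1 := by
    have : Real.Gamma (ν + 1) ≠ 0 := (Real.Gamma_pos_of_pos (by linarith)).ne'
    simp [besselCoeff, add_comm 1 ν, this]
  have hstep : ∀ k : ℕ, besselCoeff ν (k + 1) = besselCoeff ν k / ((k + 1) * (ν + 1 + k)) := by
    intro k
    have hk : (0 : ℝ) ≤ k := k.cast_nonneg
    have hk1 : 0 < ν + 1 + k := by linarith
    rw [besselCoeff_eq hν k, ← succ_mul_besselCoeff_succ]
    field_simp
  have n1 : ν + 1 ≠ 0 := by linarith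
  have n2 : ν + 2 ≠ 0 := by linarith
  have n3 : ν + 3 ≠ 0 := by linarith
  -- The factors `4`, `16`, `64` here and below undo the substitution `z = x²/4`.
  have hc1 : Real.Gamma (1 + ν) * besselCoeff ν 1 = 4 * (1 / (4 * (ν + 1))) := by
    rw [hstep 0, ← mul_div_assoc, hc0]
    push_cast
    rw [add_zero]
    field_simp
    norm_num
  have hc2 : Real.Gamma (1 + ν) * besselCoeff ν 2 = 16 * (1 / (32 * (ν + 1) * (ν + 2))) := by
    rw [hstep 1, ← mul_div_assoc, hc1]
    push_cast
    rw [show ν + 1 + 1 = ν + 2 by ring]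
    field_simp
    norm_num
  have hc3 : Real.Gamma (1 + ν) * besselCoeff ν 3 = 64 * (1 / (384 * (ν + 1) * (ν + 2) * (ν + 3))) := by
    rw [hstep 2, ← mul_div_assoc, hc2]
    push_cast
    rw [show ν + 1 + 2 = ν + 3 by ring]
    field_simp
    norm_num
  simp only [Function.comp, zero_add, FormalMultilinearSeries.partialSum, Finset.sum_range_succ,
    Finset.sum_range_zero, FormalMultilinearSeries.ofScalars_apply_eq, smul_eq_mul, normBesselExt]
  linear_combination (-1 : ℝ) * hc0 - x ^ 2 / 4 * hc1 - (x ^ 2 / 4) ^ 2 * hc2 -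
    (x ^ 2 / 4) ^ 3 * hc3

/-- The factor of `1 / n ^ (k + 1)` in the expansion of `besselIntegral ν n`, for `k ≤ 6`. -/
noncomputable def expansionCoeff (ν : ℝ) : ℕ → ℝ
  | 0 => 1
  | 1 => 1 / (2 * (1 + ν))
  | 2 => 3 / (4 * (1 + ν) ^ 2)
  | 3 => 3 * (8 + 3 * ν) / (8 * (1 + ν) ^ 3 * (2 + ν))
  | 4 => 15 * (8 + ν) / (16 * (1 + ν) ^ 4 * (2 + ν))
  | 5 => 15 * (142 + 11 * ν - 5 * ν ^ 2) / (32 * (1 + ν) ^ 5 * (2 + ν) * (3 + ν))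
  | 6 => 105 * (272 + 8 * ν - 71 * ν ^ 2 - 5 * ν ^ 3) /
      (64 * (1 + ν) ^ 6 * (2 + ν) ^ 2 * (3 + ν))
  | _ => 0

/-- Evaluate the reversion formula at `x = x(τ)`, where `y = ψ(x(τ)) = τ`; its coefficients must
then equal `expansionCoeff ν k / (k+1)!`. -/
lemma phaseInv_sub_sum_expansionCoeff_isBigO {ν : ℝ} (hν : -(1 / 2) < ν) :
    (fun τ => phaseInv ν τ - ∑ k ∈ Finset.range 7, expansionCoeff ν k / (k + 1)! * τ ^ (k + 1))
      =O[𝓝[>] 0] fun τ => τ ^ (7 + 1) := by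
  have h1 : -1 < ν := by linarith
  have hlog := log_sub_isBigO (normBesselExt_sub_isBigO h1) (by
    simpa [normBesselExt_zero h1] using (analyticAt_normBesselExt h1 0).continuousAt.tendsto)
  set α := 1 / (4 * (ν + 1)) with hα
  set β := 1 / (32 * (ν + 1) * (ν + 2)) with hβ
  set γ := 1 / (384 * (ν + 1) * (ν + 2) * (ν + 3)) with hγ
  have hrev := reversion_sub_isBigO (y := phaseExt ν) (a := α) (b := β - α ^ 2 / 2)
    (c := γ - α * β + α ^ 3 / 3)
    (hlog.neg_left.congr_left fun x => by simp only [phaseExt]; ring)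
    (by simpa [phaseExt_zero h1] using (analyticAt_phaseExt h1 0).continuousAt.tendsto)
  have ht : Tendsto (phaseInv ν) (𝓝[>] 0) (𝓝 0) :=
    (tendsto_phaseInv hν).mono_right nhdsWithin_le_nhds
  refine ((hrev.comp_tendsto ht).trans ((phaseInv_isBigO hν).pow 8)).congr' ?_ EventuallyEq.rfl
  filter_upwards [self_mem_nhdsWithin] with τ hτ
  have hψ : phaseExt ν (phaseInv ν τ) = τ := by
    rw [← phase_eq_ext ν (phaseInv_pos hν hτ), phase_phaseInv hν hτ]
  have n1 : 1 + ν ≠ 0 := by linarith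
  have n2 : 2 + ν ≠ 0 := by linarith
  have n3 : 3 + ν ≠ 0 := by linarith
  have c2 : α = 1 / (2 * (1 + ν)) / 2 := by
    rw [hα, add_comm ν]; field_simp; norm_num
  have c3 : 2 * α ^ 2 = 3 / (4 * (1 + ν) ^ 2) / 6 := by
    rw [hα, add_comm ν]; field_simp; norm_num
  have c4 : β - α ^ 2 / 2 + 5 * α ^ 3 =
      3 * (8 + 3 * ν) / (8 * (1 + ν) ^ 3 * (2 + ν)) / 24 := by
    rw [hα, hβ, add_comm ν, add_comm ν]; field_simp; ring
  have c5 : 6 * α * (β - α ^ 2 / 2) + 14 * α ^ 4 =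
      15 * (8 + ν) / (16 * (1 + ν) ^ 4 * (2 + ν)) / 120 := by
    rw [hα, hβ, add_comm ν, add_comm ν]; field_simp; ring
  have c6 : (γ - α * β + α ^ 3 / 3) + 28 * α ^ 2 * (β - α ^ 2 / 2) + 42 * α ^ 5 =
      15 * (142 + 11 * ν - 5 * ν ^ 2) / (32 * (1 + ν) ^ 5 * (2 + ν) * (3 + ν)) / 720 := by
    rw [hα, hβ, hγ, add_comm ν, add_comm ν, add_comm ν]; field_simp; ring
  have c7 : 4 * (β - α ^ 2 / 2) ^ 2 + 8 * α * (γ - α * β + α ^ 3 / 3) +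
      120 * α ^ 3 * (β - α ^ 2 / 2) + 132 * α ^ 6 =
      105 * (272 + 8 * ν - 71 * ν ^ 2 - 5 * ν ^ 3) /
        (64 * (1 + ν) ^ 6 * (2 + ν) ^ 2 * (3 + ν)) / 5040 := by
    rw [hα, hβ, hγ, add_comm ν, add_comm ν, add_comm ν]; field_simp; ring
  simp only [Function.comp, hψ, Finset.sum_range_succ, Finset.sum_range_zero, expansionCoeff,
    c3, c4, c5, c6, c7]
  -- This comes last because `c2` rewrites the bare `α`, which also occurs in the left sides of `c3`
  -- to `c7`.
  rw [c2]
  norm_num [Nat.factorial]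

end expansion

/-! ### Assembly -/

theorem theorem1 (ν : ℝ) (hν : -(1 / 2) < ν) :
    (∀ᶠ n : ℝ in atTop, IntegrableOn (besselIntegrand ν n) (Ioi 0)) ∧
    BijOn (phase ν) (Ioi 0) (Ioi 0) ∧
    (∃ A : ℕ → ℝ, IsInversionCoeff ν A ∧
      ∀ N : ℕ,
        (fun n : ℝ => besselIntegral ν n -
            ∑ k ∈ Finset.range N, (k ! : ℝ) * A k / n ^ (k + 1))
          =O[atTop] (fun n : ℝ => 1 / n ^ (N + 1))) ∧
    (fun n : ℝ => besselIntegral ν n -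
        1 / n * (1
          + 1 / (2 * (1 + ν) * n)
          + 3 / (4 * (1 + ν) ^ 2 * n ^ 2)
          + 3 * (8 + 3 * ν) / (8 * (1 + ν) ^ 3 * (2 + ν) * n ^ 3)
          + 15 * (8 + ν) / (16 * (1 + ν) ^ 4 * (2 + ν) * n ^ 4)
          + 15 * (142 + 11 * ν - 5 * ν ^ 2)
              / (32 * (1 + ν) ^ 5 * (2 + ν) * (3 + ν) * n ^ 5)
          + 105 * (272 + 8 * ν - 71 * ν ^ 2 - 5 * ν ^ 3)
              / (64 * (1 + ν) ^ 6 * (2 + ν) ^ 2 * (3 + ν) * n ^ 6)))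
      =O[atTop] (fun n : ℝ => 1 / n ^ 8) := by
  refine ⟨?_, bijOn_phase hν, ?_, ?_⟩
  · filter_upwards [(tendsto_id.const_mul_atTop (decayExponent_pos hν)).eventually_gt_atTop 1]
      with n hn
    have h := integrableOn_exp_neg_mul_phase_mul_pow hν (n := n) 0 (by simpa using hn)
    refine h.congr_fun (fun x hx => ?_) measurableSet_Ioi
    simp only [pow_zero, one_mul]
    exact (besselIntegrand_eq (by linarith) n hx).symm
  · obtain ⟨g, hg, hg0, heq⟩ := exists_analyticAt_phaseInv hν
    refine ⟨_, isInversionCoeff_of_analyticAt hg heq, fun N => ?_⟩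
    have h := besselIntegral_isBigO hν (((isBigO_sub_sum_iteratedDeriv hg hg0 N).mono
      nhdsWithin_le_nhds).congr' (heq.symm.sub EventuallyEq.rfl) EventuallyEq.rfl)
    refine h.congr_left fun n => ?_
    congr 1
    refine Finset.sum_congr rfl fun k _ => ?_
    -- Both `(k+1)! a_k` and `k! A_k` equal the derivative of order `k + 1` of `g` at `0`.
    rw [mul_div_cancel₀ _ (by positivity), mul_div_cancel₀ _ (by positivity)]
  -- The explicit terms come directly from the order-seven expansion of `x(τ)`, without identifying
  -- them with the `A_k` above.
  · have h := besselIntegral_isBigO hν (phaseInv_sub_sum_expansionCoeff_isBigO hν)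
    refine h.congr_left fun n => ?_
    congr 1
    rw [Finset.sum_congr rfl fun k _ => by rw [mul_div_cancel₀ _ (by positivity)]]
    simp only [Finset.sum_range_succ, Finset.sum_range_zero, expansionCoeff]
    simp only [div_eq_mul_inv, mul_inv]
    ring
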